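/- Let $n\ge 2$ and $\nu\ge 0$ be integers, and let $p_\nu\in\mathbb{C}[x_1,\dots,x_n]$ be a harmonic homogeneous polynomial of degree $\nu$ (that is, $\sum_{j}\partial^2 p_\nu/\partial x_j^2=0$). Write $e(w)=e^{2\pi i w}$ and, for $z$ in the upper half plane $\mathbb{H}$, $$\theta(z)=\sum_{x\in\mathbb{Z}^n}p_\nu(x)\,e(|x|^2z),\qquad |x|^2=x_1^2+\dots+x_n^2 .$$ For $\gamma=\begin{pmatrix}a&b\\c&d\end{pmatrix}\in\Gamma_0(4)=\{\gamma\in SL_2(\mathbb{Z}):4\mid c\}$ let $$j(\gamma,z)=\left(\frac cd\right)\varepsilon_d^{-1}(cz+d)^{1/2},$$ where $\varepsilon_d=1$ if $d\equiv1 \pmod 4$ and $\varepsilon_d=i$ if $d\equiv3\pmod 4$, the square root is the principal one (with $\sqrt{-1}=i$), and $\left(\frac cd\right)$ is the quadratic residue symbol in Shimura's extension: the Jacobi symbol $\left(\frac c{|d|}\right)$, multiplied by $-1$ if both $c<0$ and $d<0$ (so that $\left(\frac 0{\pm1}\right)=1$). Then the series converges absolutely for every $z\in\mathbb{H}$, $\theta$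 is holomorphic on $\mathbb{H}$, and $$\theta(\gamma z)=j(\gamma,z)^{2\nu+n}\,\theta(z)\qquad\text{for all }\gamma\in\Gamma_0(4),\ z\in\mathbb{H}.$$ If moreover $\nu>0$, then $\theta$ is a cusp form of weight $\nu+n/2$ on $\Gamma_0(4)$: in addition to the above it vanishes at every cusp, i.e. for every $\begin{pmatrix}a&b\\c&d\end{pmatrix}\in SL_2(\mathbb{Z})$, $$(cz+d)^{-(\nu+n/2)}\,\theta\!\left(\frac{az+b}{cz+d}\right)\longrightarrow0\quad\text{as }\operatorname{Im}z\to\infty,$$ uniformly in $\operatorname{Re}z$. -/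

import Mathlib

open scoped UpperHalfPlane MatrixGroups Manifold NumberTheorySymbols

noncomputable section

namespace ThetaHarmonic

/-- The Laplacian `∑ ∂²/∂x_i²` on complex polynomials in `n` variables. -/
def laplacian {n : ℕ} (p : MvPolynomial (Fin n) ℂ) : MvPolynomial (Fin n) ℂ :=
  ∑ i, MvPolynomial.pderiv i (MvPolynomial.pderiv i p)

/-- A polynomial is harmonic if its Laplacian vanishes. -/
def IsHarmonic {n : ℕ} (p : MvPolynomial (Fin n) ℂ) : Prop :=
  laplacian p = 0

/-- `e(w) = exp(2πiw)`. -/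
def e (w : ℂ) : ℂ :=
  Complex.exp (2 * Real.pi * Complex.I * w)

/-- The term `p(x) e(|x|² z)` of the theta series, for `x ∈ ℤⁿ`. -/
def thetaTerm {n : ℕ} (p : MvPolynomial (Fin n) ℂ) (z : ℍ) (x : Fin n → ℤ) : ℂ :=
  MvPolynomial.eval (fun i => (x i : ℂ)) p * e ((∑ i, (x i : ℂ) ^ 2) * (z : ℂ))

/-- The theta series `θ(z) = ∑_{x ∈ ℤⁿ} p(x) e(|x|² z)`. -/
def theta {n : ℕ} (p : MvPolynomial (Fin n) ℂ) (z : ℍ) : ℂ :=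
  ∑' x : Fin n → ℤ, thetaTerm p z x

/-- Shimura's extension `(c/d)` of the quadratic residue symbol to odd integers `d` of either
sign: the Jacobi symbol `(c/|d|)`, with an additional sign exactly when `c` and `d` are both
negative. In particular the symbol is `1` for `c = 0`, `d = ±1`, and for
`d = -1`, `c ≠ 0` it is the sign of `c`. -/
def shimuraSymbol (c d : ℤ) : ℤ :=
  if c < 0 ∧ d < 0 then -J(c | d.natAbs) else J(c | d.natAbs)

/-- For odd `d`: `ε_d = 1` if `d ≡ 1 mod 4`, and `ε_d = i` if `d ≡ 3 mod 4`. -/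
def eps (d : ℤ) : ℂ :=
  if d % 4 = 1 then 1 else Complex.I

/-- The theta multiplier `j(γ, z) = (c/d) ε_d⁻¹ (cz+d)^{1/2}`, where `(c, d)` is the bottom row
of `γ` and the square root is the principal one (argument in `(-π/2, π/2]`). -/
def thetaMultiplier (γ : SL(2, ℤ)) (z : ℍ) : ℂ :=
  (shimuraSymbol (γ 1 0) (γ 1 1) : ℂ) * (eps (γ 1 1))⁻¹ *
    ((γ 1 0 : ℂ) * (z : ℂ) + (γ 1 1 : ℂ)) ^ (1 / 2 : ℂ)

/-- `f` is a cusp form of weight `k / 2` on `Γ₀(4)`, with respect to the theta multiplier: it is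
holomorphic on the upper half plane, it transforms by `j(γ, z)^k` under every `γ ∈ Γ₀(4)`, and it
vanishes at every cusp, that is, for every `g ∈ SL₂(ℤ)` with bottom row `(c, d)` the function
`(cz+d)^{-k/2} f(gz)` tends to `0` as `Im z → ∞`. -/
structure IsCuspFormGamma0Four (k : ℕ) (f : ℍ → ℂ) : Prop where
  holomorphic : MDifferentiable 𝓘(ℂ) 𝓘(ℂ) f
  transform : ∀ γ ∈ CongruenceSubgroup.Gamma0 4, ∀ z : ℍ,
    f (γ • z) = thetaMultiplier γ z ^ k * f z
  zero_at_cusps : ∀ g : SL(2, ℤ), UpperHalfPlane.IsZeroAtImInfty fun z : ℍ =>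
    ((g 1 0 : ℂ) * (z : ℂ) + (g 1 1 : ℂ)) ^ (-(k : ℂ) / 2) * f (g • z)

end ThetaHarmonic

end

/-!
Theta series with characteristics `(v, w)` make an induction on the degree `ν` possible. For
`ν = 0` the inversion formula under `τ ↦ -1 / τ` is a product of Jacobi's functional equations.
Differentiating it in `w` multiplies the coefficient polynomial by a variable, and Euler's identity
`ν p = ∑ xᵢ ∂ᵢ p` reassembles a harmonic `p` from its harmonic derivatives.

`Γ₀(4)` is generated by `T`, `-1` and `(1 0; 4 1)`. The last one is an inversion of `2 z`, a
translation by `-2` and another inversion, while `j(γ, z)` satisfies the matching cocycle relation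
by quadratic reciprocity.

For the cusps, `SL(2, ℤ)` permutes the series with real characteristics up to a phase and the
automorphy factor. Their terms decay exponentially as `Im τ → ∞`, except the one with `x + v = 0`,
which has the coefficient `p(0) = 0` when `ν > 0`. Although `2 (g z)` is not of the form `g (2 z)`,
it equals `g' w` for some `g'` in `SL(2, ℤ)` and `w` affine in `z`.
-/

namespace ThetaHarmonic

section SquareRoot

open Complex

lemma mul_cpow_of_arg_add_mem {x y : ℂ} (hx : x ≠ 0) (hy : y ≠ 0)
    (hxy : x.arg + y.arg ∈ Set.Ioc (-Real.pi) Real.pi) (s : ℂ) :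
    (x * y) ^ s = x ^ s * y ^ s := by
  rw [cpow_def_of_ne_zero (mul_ne_zero hx hy), cpow_def_of_ne_zero hx, cpow_def_of_ne_zero hy,
    log_mul hx hy hxy, add_mul, exp_add]

lemma div_cpow_of_re_pos {x y : ℂ} (hx : 0 < x.re) (hy : 0 < y.re) (s : ℂ) :
    (x / y) ^ s = x ^ s / y ^ s := by
  have hx0 : x ≠ 0 := fun h => by simp [h] at hx
  have hy0 : y ≠ 0 := fun h => by simp [h] at hy
  have hargx := abs_lt.1 (abs_arg_lt_pi_div_two_iff.2 (Or.inl hx))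
  have hargy := abs_lt.1 (abs_arg_lt_pi_div_two_iff.2 (Or.inl hy))
  have hpi : y.arg ≠ Real.pi := by linarith [Real.pi_pos]
  have hadd : x.arg + y⁻¹.arg ∈ Set.Ioc (-Real.pi) Real.pi := by
    rw [arg_inv, if_neg hpi]
    constructor <;> linarith
  rw [div_eq_mul_inv, mul_cpow_of_arg_add_mem hx0 (inv_ne_zero hy0) hadd, inv_cpow _ _ hpi,
    div_eq_mul_inv]

lemma mul_cpow_half_of_im_pos {u v : ℂ} (hu : u ≠ 0) (hv : 0 < v.im) :
    (u * v) ^ (1 / 2 : ℂ) =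
      (if 0 ≤ u.im ∧ (u * v).im < 0 then -1 else 1) *
        (u ^ (1 / 2 : ℂ) * v ^ (1 / 2 : ℂ)) := by
  have hv0 : v ≠ 0 := fun h => by simp [h] at hv
  have huv0 : u * v ≠ 0 := mul_ne_zero hu hv0
  have hargv : 0 < v.arg ∧ v.arg < Real.pi := by
    refine ⟨(arg_nonneg_iff.2 hv.le).lt_of_ne' fun h => ?_, arg_lt_pi_iff.2 (Or.inr hv.ne')⟩
    exact hv.ne' (arg_eq_zero_iff.1 h).2
  have hargu := arg_mem_Ioc u
  simp only [← arg_nonneg_iff, ← arg_neg_iff]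
  rcases le_or_gt (u.arg + v.arg) Real.pi with hle | hgt
  · have hmem : u.arg + v.arg ∈ Set.Ioc (-Real.pi) Real.pi := ⟨by linarith [hargu.1], hle⟩
    rw [arg_mul hu hv0 hmem, if_neg (by rintro ⟨h₁, h₂⟩; linarith), one_mul,
      mul_cpow_of_arg_add_mem hu hv0 hmem]
  · have harg : (u * v).arg = u.arg + v.arg - 2 * Real.pi := by
      have hmem : u.arg + v.arg - 2 * Real.pi ∈ Set.Ioc (-Real.pi) Real.pi :=
        ⟨by linarith, by linarith [hargu.2]⟩
      rw [← arg_coe_angle_toReal_eq_arg, arg_mul_coe_angle hu hv0, ← Real.Angle.coe_add,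
        ← Real.Angle.toReal_coe_eq_self_iff_mem_Ioc.2 hmem]
      simp
    have hlog : log (u * v) = log u + log v - 2 * Real.pi * I := by
      apply Complex.ext
      · simp [log_re, Real.log_mul (norm_ne_zero_iff.2 hu) (norm_ne_zero_iff.2 hv0)]
      · simp [log_im, harg]
    rw [if_pos ⟨by linarith, by linarith [hargu.2]⟩, cpow_def_of_ne_zero huv0,
      cpow_def_of_ne_zero hu, cpow_def_of_ne_zero hv0, hlog, ← exp_add, ← exp_neg_pi_mul_I,
      ← exp_add]
    ring_nf

end SquareRoot

section ShimuraSymbol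

lemma jacobiSym_add_right {m b : ℕ} (hm : 4 ∣ m) (hb : Odd b) : J(m | b + m) = J(m | b) := by
  obtain ⟨k, rfl⟩ := hm
  have hb' : Odd (b + 4 * k) := by grind
  rw [Nat.cast_mul, jacobiSym.mul_left, jacobiSym.mul_left, Nat.cast_ofNat, jacobiSym.at_four hb,
    jacobiSym.at_four hb', jacobiSym.mod_right' k hb, jacobiSym.mod_right' k hb',
    Nat.add_mod_right]

lemma jacobiSym_eq_of_add_eq {m a b : ℕ} (hm : 4 ∣ m) (ha : Odd a) (hb : Odd b)
    (h : a + b = m) : J(m | a) = J(m | b) := by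
  subst h
  have hmod : a % 4 = 1 ∨ b % 4 = 1 := by grind
  have hreciprocity : J(b | a) = J(a | b) := by
    rcases hmod with h | h
    · exact (jacobiSym.quadratic_reciprocity_one_mod_four h hb).symm
    · exact jacobiSym.quadratic_reciprocity_one_mod_four h ha
  calc J((a + b : ℕ) | a) = J(b | a) := jacobiSym.mod_left' (by simp)
    _ = J(a | b) := hreciprocity
    _ = J((a + b : ℕ) | b) := jacobiSym.mod_left' (by simp)

lemma jacobiSym_natAbs_add {m : ℕ} {d : ℤ} (hm : 4 ∣ m) (hd : Odd d) :
    J(m | (d + m).natAbs) = J(m | d.natAbs) := by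
  have hd' : Odd d.natAbs := hd.natAbs
  rcases le_or_gt 0 d with h0 | hneg
  · rw [show (d + m).natAbs = d.natAbs + m by lia]
    exact jacobiSym_add_right hm hd'
  rcases le_or_gt 0 (d + m) with h0 | hneg'
  · exact jacobiSym_eq_of_add_eq hm (by grind) hd' (by lia)
  · rw [show d.natAbs = (d + m).natAbs + m by lia]
    exact (jacobiSym_add_right hm (by grind)).symm

lemma shimuraSymbol_eq_jacobiSym_natAbs {c d : ℤ} (hd : Odd d) :
    shimuraSymbol c d = (if c < 0 then ZMod.χ₄ d else 1) * J(c.natAbs | d.natAbs) := by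
  unfold shimuraSymbol
  have hd' : Odd d.natAbs := hd.natAbs
  rcases le_or_gt 0 c with hc | hc
  · simp [hc.not_gt, abs_of_nonneg hc]
  have hneg : J(c | d.natAbs) = ZMod.χ₄ d.natAbs * J(c.natAbs | d.natAbs) := by
    rw [← jacobiSym.neg _ hd']
    congr 1
    lia
  rw [hneg, ZMod.χ₄_nat_eq_if_mod_four, ZMod.χ₄_int_eq_if_mod_four]
  grind

lemma shimuraSymbol_add_right {c d : ℤ} (hc : 4 ∣ c) (hd : Odd d) :
    shimuraSymbol c (d + c) = shimuraSymbol c d := by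
  have hm : 4 ∣ c.natAbs := by lia
  have hdc : Odd (d + c) := by grind
  have hχ : ZMod.χ₄ (d + c : ℤ) = ZMod.χ₄ d := by
    rw [ZMod.χ₄_int_mod_four, ZMod.χ₄_int_mod_four d]
    congr 2
    lia
  rw [shimuraSymbol_eq_jacobiSym_natAbs hd, shimuraSymbol_eq_jacobiSym_natAbs hdc, hχ]
  congr 1
  rcases le_or_gt 0 c with h0 | hneg
  · have := jacobiSym_natAbs_add hm hd
    rwa [show (c.natAbs : ℤ) = c by lia] at this ⊢
  · have := jacobiSym_natAbs_add hm hdc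
    rwa [show d + c + (c.natAbs : ℤ) = d by lia, eq_comm] at this

lemma shimuraSymbol_add_left (c d : ℤ) :
    shimuraSymbol (c + 4 * d) d =
      (if 0 ≤ c ∧ c + 4 * d < 0 then -1 else 1) * shimuraSymbol c d := by
  have hmod : J(c + 4 * d | d.natAbs) = J(c | d.natAbs) := jacobiSym.mod_left' (by simp)
  unfold shimuraSymbol
  grind

lemma eps_add {c d : ℤ} (hc : 4 ∣ c) : eps (d + c) = eps d := by
  rw [eps, eps, show (d + c) % 4 = d % 4 by lia]

end ShimuraSymbol

section Gamma0Four

open ModularGroup (T)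
open CongruenceSubgroup (Gamma0)

/-- The matrix `(1 0; 4 1)`, which together with `T` and `-1` generates `Γ₀(4)`. -/
def lowerFour : SL(2, ℤ) := ⟨!![1, 0; 4, 1], by simp⟩

lemma mul_apply_one (g h : SL(2, ℤ)) (j : Fin 2) :
    (g * h) 1 j = g 1 0 * h 0 j + g 1 1 * h 1 j := by
  simp [Matrix.mul_apply, Fin.sum_univ_two]

lemma four_dvd_of_mem_Gamma0 {γ : SL(2, ℤ)} (hγ : γ ∈ Gamma0 4) : 4 ∣ γ 1 0 := by
  exact_mod_cast (ZMod.intCast_zmod_eq_zero_iff_dvd _ 4).1 (CongruenceSubgroup.Gamma0_mem.1 hγ)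

lemma odd_lower_right_of_four_dvd {γ : SL(2, ℤ)} (hγ : 4 ∣ γ 1 0) : Odd (γ 1 1) :=
  Int.isCoprime_two_left.1 <|
    (ModularGroup.bottom_row_coprime γ).of_isCoprime_of_dvd_left
      (dvd_trans (by norm_num) hγ)

lemma T_mem_Gamma0 (N : ℕ) : T ∈ Gamma0 N := by
  simp [CongruenceSubgroup.Gamma0_mem, ModularGroup.coe_T]

lemma lowerFour_mem_Gamma0 : lowerFour ∈ Gamma0 4 := by
  rw [CongruenceSubgroup.Gamma0_mem]
  rfl

lemma coe_lowerFour : (lowerFour : Matrix (Fin 2) (Fin 2) ℤ) = !![1, 0; 4, 1] := rfl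

lemma coe_lowerFour_inv :
    ((lowerFour⁻¹ : SL(2, ℤ)) : Matrix (Fin 2) (Fin 2) ℤ) = !![1, 0; -4, 1] := by
  simp [Matrix.SpecialLinearGroup.coe_inv, coe_lowerFour, Matrix.adjugate_fin_two]

/-- The absolute sum of the bottom row, which is what decreases in the reduction of an element of
`Γ₀(4)` to an upper triangular matrix. -/
def bottomRowSize (γ : SL(2, ℤ)) : ℕ := (γ 1 0).natAbs + (γ 1 1).natAbs

lemma exists_bottomRowSize_mul_lt {γ : SL(2, ℤ)} (hγ : 4 ∣ γ 1 0) (hc : γ 1 0 ≠ 0) :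
    (bottomRowSize (γ * T) < bottomRowSize γ ∨ bottomRowSize (γ * T⁻¹) < bottomRowSize γ) ∨
      bottomRowSize (γ * lowerFour) < bottomRowSize γ ∨
        bottomRowSize (γ * lowerFour⁻¹) < bottomRowSize γ := by
  obtain ⟨k, hk⟩ := odd_lower_right_of_four_dvd hγ
  simp only [bottomRowSize, mul_apply_one, ModularGroup.coe_T, ModularGroup.coe_T_inv,
    coe_lowerFour_inv, coe_lowerFour, Matrix.of_apply, Matrix.cons_val', Matrix.cons_val_zero,
    Matrix.cons_val_one, Matrix.cons_val_fin_one]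
  lia

lemma Gamma0_four_induction {P : SL(2, ℤ) → Prop}
    (hT : ∀ γ ∈ Gamma0 4, P (γ * T) ↔ P γ) (hU : ∀ γ ∈ Gamma0 4, P (γ * lowerFour) ↔ P γ)
    (hP : ∀ γ : SL(2, ℤ), γ 1 0 = 0 → P γ) (γ : SL(2, ℤ)) (hγ : γ ∈ Gamma0 4) : P γ := by
  induction hN : bottomRowSize γ using Nat.strong_induction_on generalizing γ with
  | _ N ih
  subst hN
  by_cases hc : γ 1 0 = 0
  · exact hP γ hc
  have hTmem := T_mem_Gamma0 4
  have hUmem := lowerFour_mem_Gamma0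
  rcases exists_bottomRowSize_mul_lt (four_dvd_of_mem_Gamma0 hγ) hc with
    (hlt | hlt) | hlt | hlt
  · exact (hT γ hγ).1 (ih _ hlt _ (mul_mem hγ hTmem) rfl)
  · have hmem := mul_mem hγ (inv_mem hTmem)
    simpa using (hT _ hmem).2 (ih _ hlt _ hmem rfl)
  · exact (hU γ hγ).1 (ih _ hlt _ (mul_mem hγ hUmem) rfl)
  · have hmem := mul_mem hγ (inv_mem hUmem)
    simpa using (hU _ hmem).2 (ih _ hlt _ hmem rfl)

end Gamma0Four

section Multiplier

open Complex
open UpperHalfPlane (denom)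
open ModularGroup (T S)
open CongruenceSubgroup (Gamma0)

lemma denom_mul (g h : SL(2, ℤ)) (z : ℍ) :
    denom (g * h : SL(2, ℤ)) z = denom g (h • z : ℍ) * denom h z := by
  rw [map_mul, map_mul, UpperHalfPlane.denom_cocycle _ _ z.im_ne_zero,
    ModularGroup.sl_moeb, UpperHalfPlane.coe_smul_of_det_pos (by simp)]

lemma denom_T (z : ℍ) : denom T z = 1 := by
  simp [ModularGroup.denom_apply, ModularGroup.coe_T]

lemma denom_lowerFour (z : ℍ) : denom lowerFour z = 4 * z + 1 := by
  simp [ModularGroup.denom_apply, coe_lowerFour]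

lemma im_denom (g : SL(2, ℤ)) (z : ℍ) : (denom g z).im = g 1 0 * z.im := by
  simp [ModularGroup.denom_apply]

lemma coe_T_smul (z : ℍ) : ((T • z : ℍ) : ℂ) = z + 1 := by
  rw [UpperHalfPlane.modular_T_smul, UpperHalfPlane.coe_vadd, ofReal_one, add_comm]

lemma coe_S_smul (z : ℍ) : ((S • z : ℍ) : ℂ) = -1 / z := by
  rw [UpperHalfPlane.modular_S_smul, UpperHalfPlane.coe_mk, ← neg_inv, neg_div, one_div]

lemma coe_lowerFour_smul (z : ℍ) : ((lowerFour • z : ℍ) : ℂ) = z / (4 * z + 1) := by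
  simp [UpperHalfPlane.specialLinearGroup_apply, coe_lowerFour]

lemma thetaMultiplier_eq_denom (γ : SL(2, ℤ)) (z : ℍ) :
    thetaMultiplier γ z =
      shimuraSymbol (γ 1 0) (γ 1 1) * (eps (γ 1 1))⁻¹ * denom γ z ^ (1 / 2 : ℂ) := rfl

lemma thetaMultiplier_mul_T {γ : SL(2, ℤ)} (hγ : γ ∈ Gamma0 4) (z : ℍ) :
    thetaMultiplier (γ * T) z = thetaMultiplier γ (T • z) * 1 := by
  have hc := four_dvd_of_mem_Gamma0 hγ
  have h₀ : (γ * T) 1 0 = γ 1 0 := by simp [mul_apply_one, ModularGroup.coe_T]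
  have h₁ : (γ * T) 1 1 = γ 1 1 + γ 1 0 := by
    simp [mul_apply_one, ModularGroup.coe_T, add_comm]
  rw [thetaMultiplier_eq_denom, thetaMultiplier_eq_denom, h₀, h₁, eps_add hc,
    shimuraSymbol_add_right hc (odd_lower_right_of_four_dvd hc), denom_mul, denom_T, mul_one,
    mul_one]

lemma thetaMultiplier_mul_lowerFour (γ : SL(2, ℤ)) (z : ℍ) :
    thetaMultiplier (γ * lowerFour) z =
      thetaMultiplier γ (lowerFour • z) * (4 * (z : ℂ) + 1) ^ (1 / 2 : ℂ) := by
  have h₀ : (γ * lowerFour) 1 0 = γ 1 0 + 4 * γ 1 1 := by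
    simp [mul_apply_one, coe_lowerFour, mul_comm]
  have h₁ : (γ * lowerFour) 1 1 = γ 1 1 := by simp [mul_apply_one, coe_lowerFour]
  have hroot := mul_cpow_half_of_im_pos (v := denom lowerFour z)
    (UpperHalfPlane.denom_ne_zero γ (lowerFour • z)) (by simp [denom_lowerFour, z.im_pos])
  have him : 0 ≤ (denom γ (lowerFour • z : ℍ)).im ↔ 0 ≤ γ 1 0 := by
    rw [im_denom, mul_nonneg_iff_of_pos_right (lowerFour • z).im_pos, Int.cast_nonneg_iff]
  have him' : (denom (γ * lowerFour : SL(2, ℤ)) z).im < 0 ↔ γ 1 0 + 4 * γ 1 1 < 0 := by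
    rw [im_denom, h₀, ← Int.cast_lt_zero (R := ℝ), mul_neg_iff]
    simp [z.im_pos, z.im_pos.not_gt]
  rw [← denom_mul] at hroot
  simp only [him, him'] at hroot
  rw [thetaMultiplier_eq_denom, thetaMultiplier_eq_denom, h₀, h₁, shimuraSymbol_add_left, hroot,
    ← denom_lowerFour]
  split_ifs <;> push_cast <;> ring

lemma thetaMultiplier_of_lower_left_eq_zero {γ : SL(2, ℤ)} (hγ : γ 1 0 = 0) (z : ℍ) :
    thetaMultiplier γ z = 1 := by
  have hunit : IsUnit (γ 1 1) := by
    simpa [hγ, isCoprime_zero_left] using ModularGroup.bottom_row_coprime γ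
  have hI : (-1 : ℂ) ^ (1 / 2 : ℂ) = I := by
    rw [cpow_def_of_ne_zero (by norm_num), log_neg_one, mul_one_div, mul_div_right_comm,
      exp_pi_div_two_mul_I]
  rw [thetaMultiplier, hγ]
  rcases Int.isUnit_iff.1 hunit with h | h <;> simp only [h]
  · simp [shimuraSymbol, eps]
  · simp only [Int.cast_zero, zero_mul, zero_add, Int.cast_neg, Int.cast_one, hI]
    simp [shimuraSymbol, eps]

lemma transform_mul_iff {f : ℍ → ℂ} {k : ℕ} {γ g : SL(2, ℤ)} {u : ℍ → ℂ}
    (hj : ∀ z, thetaMultiplier (γ * g) z = thetaMultiplier γ (g • z) * u z)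
    (hf : ∀ z, f (g • z) = u z ^ k * f z) :
    (∀ z, f ((γ * g) • z) = thetaMultiplier (γ * g) z ^ k * f z) ↔
      ∀ z, f (γ • z) = thetaMultiplier γ z ^ k * f z := by
  rw [(MulAction.surjective g).forall (p := fun z => f (γ • z) = thetaMultiplier γ z ^ k * f z)]
  simp only [hj, hf, mul_smul, mul_pow, mul_assoc]

lemma transform_of_generators {f : ℍ → ℂ} {k : ℕ} (hT : ∀ z, f (T • z) = f z)
    (hU : ∀ z, f (lowerFour • z) = ((4 * (z : ℂ) + 1) ^ (1 / 2 : ℂ)) ^ k * f z) :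
    ∀ γ ∈ Gamma0 4, ∀ z, f (γ • z) = thetaMultiplier γ z ^ k * f z := by
  refine Gamma0_four_induction ?_ ?_ ?_
  · exact fun γ hγ => transform_mul_iff (thetaMultiplier_mul_T hγ) (by simpa using hT)
  · exact fun γ _ => transform_mul_iff (thetaMultiplier_mul_lowerFour γ) hU
  · intro γ hγ z
    have hzpow : ∀ m : ℤ, f (T ^ m • z) = f z := fun m => by
      induction m with
      | zero => simp
      | succ m ih => rw [add_comm, zpow_add, zpow_one, mul_smul, hT, ih]
      | pred m ih =>
        rw [← hT, ← mul_smul, ← zpow_one_add]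
        simpa using ih
    obtain ⟨m, hm⟩ := ModularGroup.exists_eq_T_zpow_of_c_eq_zero hγ
    rw [hm, hzpow, thetaMultiplier_of_lower_left_eq_zero hγ, one_pow, one_mul]

end Multiplier

section Bounds

lemma summable_norm_prod_and_tsum_prod {ι R : Type*} [NormedCommRing R] [CompleteSpace R] {n : ℕ}
    {f : Fin n → ι → R} (hf : ∀ i, Summable fun k => ‖f i k‖) :
    (Summable fun x : Fin n → ι => ‖∏ i, f i (x i)‖) ∧
      ∑' x : Fin n → ι, ∏ i, f i (x i) = ∏ i, ∑' k, f i k := by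
  induction n with
  | zero => exact ⟨summable_of_hasFiniteSupport (Set.toFinite _), by simp⟩
  | succ n ih =>
    obtain ⟨hsum, htsum⟩ := ih fun i => hf i.succ
    have hcons (y : ι × (Fin n → ι)) :
        ∏ i, f i ((Fin.consEquiv fun _ : Fin (n + 1) => ι) y i) =
          f 0 y.1 * ∏ i : Fin n, f i.succ (y.2 i) := by
      simp [Fin.prod_univ_succ, Fin.consEquiv]
    constructor
    · rw [← (Fin.consEquiv fun _ : Fin (n + 1) => ι).summable_iff]
      exact ((hf 0).mul_norm hsum).congr fun y => by rw [Function.comp_apply, hcons]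
    · rw [← (Fin.consEquiv fun _ : Fin (n + 1) => ι).tsum_eq]
      simp only [hcons, Fin.prod_univ_succ, ← htsum]
      exact (tsum_mul_tsum_of_summable_norm (hf 0) hsum).symm

lemma exists_norm_eval_le {σ 𝕜 : Type*} [Fintype σ] [NormedField 𝕜] (q : MvPolynomial σ 𝕜) :
    ∃ (C : ℝ) (D : ℕ), 0 ≤ C ∧
      ∀ y : σ → 𝕜, ‖MvPolynomial.eval y q‖ ≤ C * ∏ i, (1 + ‖y i‖) ^ D := by
  classical
  induction q using MvPolynomial.induction_on with
  | C a => exact ⟨‖a‖, 0, norm_nonneg _, fun y => by simp⟩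
  | add p q hp hq =>
    obtain ⟨C, D, hC, h⟩ := hp
    obtain ⟨C', D', hC', h'⟩ := hq
    refine ⟨C + C', max D D', by positivity, fun y => ?_⟩
    have hmono {k : ℕ} (hk : k ≤ max D D') :
        ∏ i, (1 + ‖y i‖) ^ k ≤ ∏ i, (1 + ‖y i‖) ^ max D D' := by
      gcongr
      simp
    rw [map_add, add_mul]
    refine (norm_add_le _ _).trans (add_le_add ((h y).trans ?_) ((h' y).trans ?_))
    · exact mul_le_mul_of_nonneg_left (hmono (le_max_left D D')) hC
    · exact mul_le_mul_of_nonneg_left (hmono (le_max_right D D')) hC'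
  | mul_X p j hp =>
    obtain ⟨C, D, hC, h⟩ := hp
    refine ⟨C, D + 1, hC, fun y => ?_⟩
    have hj : ‖y j‖ ≤ ∏ i, (1 + ‖y i‖) :=
      calc ‖y j‖ ≤ 1 + ‖y j‖ := by simp
        _ = ∏ i, if i = j then 1 + ‖y i‖ else 1 := by simp
        _ ≤ ∏ i, (1 + ‖y i‖) := by
          refine Finset.prod_le_prod (fun i _ => ?_) fun i _ => ?_ <;> split_ifs <;>
            linarith [norm_nonneg (y i)]
    rw [map_mul, norm_mul, MvPolynomial.eval_X]
    simp only [pow_succ, Finset.prod_mul_distrib, ← mul_assoc]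
    exact mul_le_mul (h y) hj (norm_nonneg _) (by positivity)

lemma summable_add_abs_pow_mul_exp {A : ℝ} (hA : 0 ≤ A) (S : ℝ) {T : ℝ} (hT : 0 < T) (D : ℕ) :
    Summable fun k : ℤ =>
      (A + |(k : ℝ)|) ^ D * Real.exp (-Real.pi * (T * k ^ 2 - 2 * S * |(k : ℝ)|)) := by
  have h₀ := (summable_pow_mul_jacobiTheta₂_term_bound S hT 0).mul_left (A ^ D)
  have hD := summable_pow_mul_jacobiTheta₂_term_bound S hT D
  refine Summable.of_nonneg_of_le (fun k => by positivity) (fun k => ?_)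
    ((h₀.add hD).mul_left (2 ^ (D - 1)))
  rw [pow_zero, one_mul, ← add_mul, ← mul_assoc]
  simp only [Int.cast_abs]
  gcongr
  exact add_pow_le hA (abs_nonneg _) D

end Bounds

section ThetaChar

open Complex MvPolynomial

variable {n : ℕ}

/-- The term `q(x + v) exp(πi ∑ⱼ ((xⱼ + vⱼ)² τ + 2 (xⱼ + vⱼ) wⱼ))` of the theta series with
characteristic `(v, w)` and polynomial coefficient `q`. -/
noncomputable def thetaCharTerm (q : MvPolynomial (Fin n) ℂ) (τ : ℂ) (v w : Fin n → ℂ)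
    (x : Fin n → ℤ) : ℂ :=
  eval (fun i => x i + v i) q *
    exp (Real.pi * I * ∑ i, ((x i + v i) ^ 2 * τ + 2 * (x i + v i) * w i))

/-- The theta series with characteristic `(v, w)` and polynomial coefficient `q`. Compared with
`theta`, the variable is normalised so that `theta q z = thetaChar q (2 * z) 0 0`. -/
noncomputable def thetaChar (q : MvPolynomial (Fin n) ℂ) (τ : ℂ) (v w : Fin n → ℂ) : ℂ :=
  ∑' x, thetaCharTerm q τ v w x

lemma exp_char_eq_jacobiTheta₂_term (τ v w : ℂ) (k : ℤ) :
    exp (Real.pi * I * ((k + v) ^ 2 * τ + 2 * (k + v) * w)) =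
      exp (Real.pi * I * (v ^ 2 * τ + 2 * v * w)) * jacobiTheta₂_term k (v * τ + w) τ := by
  rw [jacobiTheta₂_term, ← exp_add]
  ring_nf

lemma thetaCharTerm_eq_prod (q : MvPolynomial (Fin n) ℂ) (τ : ℂ) (v w : Fin n → ℂ)
    (x : Fin n → ℤ) :
    thetaCharTerm q τ v w x = eval (fun i => x i + v i) q *
      ∏ i, exp (Real.pi * I * ((x i + v i) ^ 2 * τ + 2 * (x i + v i) * w i)) := by
  rw [thetaCharTerm, Finset.mul_sum, exp_sum]

lemma norm_exp_char_le {S T : ℝ} (hT : 0 < T) {τ v w : ℂ} (hτT : T ≤ τ.im) (hτ : ‖τ‖ ≤ S)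
    (hv : ‖v‖ ≤ S) (hw : ‖w‖ ≤ S) (k : ℤ) :
    ‖exp (Real.pi * I * ((k + v) ^ 2 * τ + 2 * (k + v) * w))‖ ≤
      Real.exp (Real.pi * (S ^ 2 * S + 2 * S * S)) *
        Real.exp (-Real.pi * (T * k ^ 2 - 2 * (S * S + S) * |(k : ℝ)|)) := by
  have hS : 0 ≤ S := (norm_nonneg _).trans hτ
  have him : |(v * τ + w).im| ≤ S * S + S := by
    refine (abs_im_le_norm _).trans ((norm_add_le _ _).trans ?_)
    rw [norm_mul]
    gcongr
  have hconst : ‖Real.pi * I * (v ^ 2 * τ + 2 * v * w)‖ ≤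
      Real.pi * (S ^ 2 * S + 2 * S * S) := by
    rw [norm_mul, norm_mul, norm_I, mul_one, norm_real, Real.norm_of_nonneg Real.pi_pos.le]
    refine mul_le_mul_of_nonneg_left ((norm_add_le _ _).trans ?_) Real.pi_pos.le
    simp only [norm_mul, norm_pow, norm_ofNat]
    gcongr
  rw [exp_char_eq_jacobiTheta₂_term, norm_mul]
  refine mul_le_mul ((norm_exp_le_exp_norm _).trans (Real.exp_le_exp.2 hconst)) ?_
    (norm_nonneg _) (Real.exp_pos _).le
  simpa only [Int.cast_abs] using norm_jacobiTheta₂_term_le hT him hτT k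

lemma exists_summable_bound_thetaCharTerm (q : MvPolynomial (Fin n) ℂ) {S T : ℝ} (hS : 0 ≤ S)
    (hT : 0 < T) :
    ∃ u : (Fin n → ℤ) → ℝ, Summable u ∧ ∀ x (τ : ℂ) (v w : Fin n → ℂ),
      T ≤ τ.im → ‖τ‖ ≤ S → ‖v‖ ≤ S → ‖w‖ ≤ S → ‖thetaCharTerm q τ v w x‖ ≤ u x := by
  obtain ⟨C, D, hC, hq⟩ := exists_norm_eval_le q
  set g : ℤ → ℝ := fun k => Real.exp (Real.pi * (S ^ 2 * S + 2 * S * S)) *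
    ((1 + S + |(k : ℝ)|) ^ D *
      Real.exp (-Real.pi * (T * k ^ 2 - 2 * (S * S + S) * |(k : ℝ)|)))
  have hgs : Summable g := (summable_add_abs_pow_mul_exp (by positivity) _ hT D).mul_left _
  have hprod : Summable fun x : Fin n → ℤ => ∏ i, g (x i) :=
    (summable_norm_prod_and_tsum_prod fun _ => hgs.norm).1.of_norm
  refine ⟨fun x => C * ∏ i, g (x i), hprod.mul_left C, fun x τ v w hτT hτ hv hw => ?_⟩
  rw [thetaCharTerm_eq_prod, norm_mul, norm_prod]
  refine (mul_le_mul_of_nonneg_right (hq _) (by positivity)).trans ?_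
  rw [mul_assoc, ← Finset.prod_mul_distrib]
  refine mul_le_mul_of_nonneg_left (Finset.prod_le_prod (fun _ _ => by positivity)
    fun i _ => ?_) hC
  have hvi := (norm_le_pi_norm v i).trans hv
  have hexp := norm_exp_char_le hT hτT hτ hvi ((norm_le_pi_norm w i).trans hw) (x i)
  have hbase : 1 + ‖(x i : ℂ) + v i‖ ≤ 1 + S + |(x i : ℝ)| := by
    have := norm_add_le (x i : ℂ) (v i)
    rw [norm_intCast] at this
    linarith
  calc (1 + ‖(x i : ℂ) + v i‖) ^ D * _ ≤ (1 + S + |(x i : ℝ)|) ^ D * _ := by gcongr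
    _ = g (x i) := mul_left_comm _ _ _

lemma summable_thetaCharTerm (q : MvPolynomial (Fin n) ℂ) {τ : ℂ} (hτ : 0 < τ.im)
    (v w : Fin n → ℂ) : Summable (thetaCharTerm q τ v w) := by
  obtain ⟨u, hu, hle⟩ := exists_summable_bound_thetaCharTerm q
    (S := max ‖τ‖ (max ‖v‖ ‖w‖)) (by positivity) hτ
  exact .of_norm_bounded hu fun x => hle x τ v w le_rfl (by simp) (by simp) (by simp)

lemma thetaChar_sum {ι : Type*} (s : Finset ι) (q : ι → MvPolynomial (Fin n) ℂ) {τ : ℂ}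
    (hτ : 0 < τ.im) (v w : Fin n → ℂ) :
    thetaChar (∑ i ∈ s, q i) τ v w = ∑ i ∈ s, thetaChar (q i) τ v w := by
  simp only [thetaChar, ← Summable.tsum_finsetSum fun i _ => summable_thetaCharTerm (q i) hτ v w]
  simp only [thetaCharTerm, map_sum, Finset.sum_mul]

lemma thetaChar_nsmul (m : ℕ) (q : MvPolynomial (Fin n) ℂ) (τ : ℂ) (v w : Fin n → ℂ) :
    thetaChar (m • q) τ v w = m * thetaChar q τ v w := by
  rw [thetaChar, thetaChar, ← tsum_mul_left]
  exact tsum_congr fun x => by simp [thetaCharTerm, mul_assoc]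

lemma thetaChar_C (a : ℂ) {τ : ℂ} (hτ : 0 < τ.im) (v w : Fin n → ℂ) :
    thetaChar (C a) τ v w = a * ∏ i, (exp (Real.pi * I * (v i ^ 2 * τ + 2 * v i * w i)) *
      jacobiTheta₂ (v i * τ + w i) τ) := by
  have hsum (i : Fin n) : Summable fun k : ℤ =>
      ‖exp (Real.pi * I * (v i ^ 2 * τ + 2 * v i * w i)) *
        jacobiTheta₂_term k (v i * τ + w i) τ‖ :=
    (((summable_jacobiTheta₂_term_iff _ _).2 hτ).mul_left _).norm
  simp only [thetaChar, thetaCharTerm_eq_prod, eval_C, exp_char_eq_jacobiTheta₂_term,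
    tsum_mul_left, (summable_norm_prod_and_tsum_prod hsum).2, jacobiTheta₂]

end ThetaChar

section Derivatives

open Complex MvPolynomial Filter Topology

lemma hasDerivAt_eval {σ 𝕜 : Type*} [Fintype σ] [NontriviallyNormedField 𝕜]
    (q : MvPolynomial σ 𝕜) {y : 𝕜 → σ → 𝕜} {y' : σ → 𝕜} {t : 𝕜}
    (hy : ∀ i, HasDerivAt (fun t => y t i) (y' i) t) :
    HasDerivAt (fun t => eval (y t) q) (∑ j, y' j * eval (y t) (pderiv j q)) t := by
  classical
  induction q using MvPolynomial.induction_on with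
  | C a => simpa using hasDerivAt_const t a
  | add p q hp hq =>
    simp only [map_add, mul_add, Finset.sum_add_distrib]
    exact hp.add hq
  | mul_X p i hp =>
    simp only [map_mul, eval_X]
    refine (hp.mul (hy i)).congr_deriv ?_
    have hX (j : σ) : eval (y t) (p * pderiv j (X i)) = if j = i then eval (y t) p else 0 := by
      rw [pderiv_X]
      rcases eq_or_ne j i with rfl | hne <;> simp [*]
    simp only [Derivation.leibniz, smul_eq_mul, map_add, hX, mul_add, Finset.sum_add_distrib,
      mul_ite, mul_zero, Finset.sum_ite_eq', Finset.mem_univ, if_true, map_mul, eval_X,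
      Finset.sum_mul]
    rw [add_comm, mul_comm (y' i)]
    exact congrArg _ (Finset.sum_congr rfl fun j _ => by ring)

variable {n : ℕ}

lemma hasDerivAt_thetaCharTerm (q : MvPolynomial (Fin n) ℂ) (τ : ℂ) (v w a b : Fin n → ℂ)
    (x : Fin n → ℤ) :
    HasDerivAt (fun t : ℂ => thetaCharTerm q τ (v + t • a) (w + t • b) x)
      (∑ j, (a j * (thetaCharTerm (pderiv j q) τ v w x +
          2 * Real.pi * I * w j * thetaCharTerm q τ v w x) +
        2 * Real.pi * I * (a j * τ + b j) * thetaCharTerm (X j * q) τ v w x)) 0 := by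
  have hv (i : Fin n) : HasDerivAt (fun t : ℂ => (x i : ℂ) + (v + t • a) i) (a i) 0 := by
    simpa using (((hasDerivAt_id (0 : ℂ)).mul_const (a i)).const_add (v i)).const_add (x i : ℂ)
  have hw (i : Fin n) : HasDerivAt (fun t : ℂ => (w + t • b) i) (b i) 0 := by
    simpa using ((hasDerivAt_id (0 : ℂ)).mul_const (b i)).const_add (w i)
  have hexponent := (HasDerivAt.fun_sum (u := Finset.univ) fun i _ =>
    (((hv i).fun_pow 2).mul_const τ).fun_add (((hv i).const_mul 2).fun_mul (hw i))).const_mul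
      (Real.pi * I)
  refine ((hasDerivAt_eval q hv).fun_mul hexponent.cexp).congr_deriv ?_
  simp only [thetaCharTerm, zero_smul, add_zero, map_mul, eval_X, Finset.mul_sum, Finset.sum_mul,
    ← Finset.sum_add_distrib]
  refine Finset.sum_congr rfl fun j _ => ?_
  push_cast
  ring

lemma exists_isOpen_summable_bound (q : MvPolynomial (Fin n) ℂ) {τ : ℂ → ℂ} {v w : ℂ → Fin n → ℂ}
    (hτ : Continuous τ) (hv : Continuous v) (hw : Continuous w) {t₀ : ℂ} (ht₀ : 0 < (τ t₀).im) :
    ∃ U : Set ℂ, IsOpen U ∧ t₀ ∈ U ∧ ∃ u : (Fin n → ℤ) → ℝ, Summable u ∧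
      ∀ x, ∀ t ∈ U, ‖thetaCharTerm q (τ t) (v t) (w t) x‖ ≤ u x := by
  set S := ‖τ t₀‖ + ‖v t₀‖ + ‖w t₀‖ + 1
  have hbound : ∀ᶠ t in 𝓝 t₀,
      ((τ t₀).im / 2 < (τ t).im ∧ ‖τ t‖ < S) ∧ ‖v t‖ < S ∧ ‖w t‖ < S := by
    have hpos := norm_nonneg (τ t₀)
    have hpos' := norm_nonneg (v t₀)
    have hpos'' := norm_nonneg (w t₀)
    refine ((((continuous_im.comp hτ).tendsto t₀).eventually_const_lt ?_).and
      ((hτ.norm.tendsto t₀).eventually_lt_const ?_)).and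
        (((hv.norm.tendsto t₀).eventually_lt_const ?_).and
          ((hw.norm.tendsto t₀).eventually_lt_const ?_))
    · exact half_lt_self ht₀
    all_goals linarith
  obtain ⟨U, hU, hUo, ht₀U⟩ := eventually_nhds_iff.1 hbound
  obtain ⟨u, hu, hle⟩ :=
    exists_summable_bound_thetaCharTerm q (S := S) (by positivity) (half_pos ht₀)
  refine ⟨U, hUo, ht₀U, u, hu, fun x t ht => ?_⟩
  obtain ⟨⟨him, h₁⟩, h₂, h₃⟩ := hU t ht
  exact hle x _ _ _ him.le h₁.le h₂.le h₃.le

lemma hasDerivAt_thetaChar (q : MvPolynomial (Fin n) ℂ) {τ : ℂ → ℂ} {v w : ℂ → Fin n → ℂ}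
    (hτ : Differentiable ℂ τ) (hv : Differentiable ℂ v) (hw : Differentiable ℂ w) {t₀ : ℂ}
    (ht₀ : 0 < (τ t₀).im) :
    HasDerivAt (fun t => thetaChar q (τ t) (v t) (w t))
      (∑' x, deriv (fun t => thetaCharTerm q (τ t) (v t) (w t) x) t₀) t₀ := by
  obtain ⟨U, hU, ht₀U, u, hu, hle⟩ :=
    exists_isOpen_summable_bound q hτ.continuous hv.continuous hw.continuous ht₀
  have hdiff (x : Fin n → ℤ) :
      Differentiable ℂ fun t => thetaCharTerm q (τ t) (v t) (w t) x := by
    have hvi := differentiable_pi.1 hv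
    have hwi := differentiable_pi.1 hw
    refine Differentiable.mul (fun t => ?_) (by fun_prop)
    exact (hasDerivAt_eval q fun i => ((hvi i t).hasDerivAt.const_add (x i : ℂ))).differentiableAt
  rw [(hasSum_deriv_of_summable_norm hu (fun x => (hdiff x).differentiableOn) hU hle ht₀U).tsum_eq]
  exact ((differentiableOn_tsum_of_summable_norm hu (fun x => (hdiff x).differentiableOn) hU
    hle).differentiableAt (hU.mem_nhds ht₀U)).hasDerivAt

lemma differentiableAt_thetaChar (q : MvPolynomial (Fin n) ℂ) {τ : ℂ} (hτ : 0 < τ.im)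
    (v w : Fin n → ℂ) : DifferentiableAt ℂ (fun τ => thetaChar q τ v w) τ :=
  (hasDerivAt_thetaChar q differentiable_id (differentiable_const v) (differentiable_const w)
    hτ).differentiableAt

lemma hasDerivAt_thetaChar_left (q : MvPolynomial (Fin n) ℂ) {τ : ℂ} (hτ : 0 < τ.im)
    (v w : Fin n → ℂ) (i : Fin n) :
    HasDerivAt (fun t : ℂ => thetaChar q τ (v + t • Pi.single i 1) w)
      (thetaChar (pderiv i q) τ v w + 2 * Real.pi * I * w i * thetaChar q τ v w +
        2 * Real.pi * I * τ * thetaChar (X i * q) τ v w) 0 := by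
  have hderiv := hasDerivAt_thetaChar q (t₀ := 0) (differentiable_const τ)
    (by fun_prop : Differentiable ℂ fun t : ℂ => v + t • Pi.single i 1)
    (differentiable_const w) hτ
  have hterm (x : Fin n → ℤ) := by
    simpa [Pi.single_apply, add_mul, Finset.sum_add_distrib] using
      (hasDerivAt_thetaCharTerm q τ v w (Pi.single i 1) 0 x).deriv
  have hsum (q : MvPolynomial (Fin n) ℂ) := summable_thetaCharTerm q hτ v w
  refine hderiv.congr_deriv ?_
  simp only [hterm, thetaChar, ← tsum_mul_left]
  rw [((hsum _).add ((hsum _).mul_left _)).tsum_add ((hsum _).mul_left _),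
    (hsum _).tsum_add ((hsum _).mul_left _)]

lemma hasDerivAt_thetaChar_right (q : MvPolynomial (Fin n) ℂ) {τ : ℂ} (hτ : 0 < τ.im)
    (v w : Fin n → ℂ) (i : Fin n) :
    HasDerivAt (fun t : ℂ => thetaChar q τ v (w + t • Pi.single i 1))
      (2 * Real.pi * I * thetaChar (X i * q) τ v w) 0 := by
  have hderiv := hasDerivAt_thetaChar q (t₀ := 0) (differentiable_const τ)
    (differentiable_const v)
    (by fun_prop : Differentiable ℂ fun t : ℂ => w + t • Pi.single i 1) hτ
  have hterm (x : Fin n → ℤ) := by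
    simpa [Pi.single_apply] using
      (hasDerivAt_thetaCharTerm q τ v w 0 (Pi.single i 1) x).deriv
  refine hderiv.congr_deriv ?_
  simp only [hterm, thetaChar, tsum_mul_left]

end Derivatives

section HarmonicPolynomial

open MvPolynomial

lemma pderiv_pderiv_comm {σ R : Type*} [CommSemiring R] (i j : σ) (p : MvPolynomial σ R) :
    pderiv i (pderiv j p) = pderiv j (pderiv i p) := by
  classical
  rcases eq_or_ne i j with rfl | hij
  · rfl
  · ext m
    simp [coeff_pderiv, hij, hij.symm, add_right_comm, mul_right_comm]

lemma IsHarmonic.pderiv {n : ℕ} {p : MvPolynomial (Fin n) ℂ} (hp : IsHarmonic p) (i : Fin n) :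
    IsHarmonic (pderiv i p) := by
  have hcomm : laplacian (MvPolynomial.pderiv i p) = MvPolynomial.pderiv i (laplacian p) := by
    simp only [laplacian, map_sum, pderiv_pderiv_comm _ i]
  rw [IsHarmonic, hcomm, hp, map_zero]

end HarmonicPolynomial

section Inversion

open Complex MvPolynomial Matrix

variable {n : ℕ}

lemma im_neg_one_div_pos {τ : ℂ} (hτ : 0 < τ.im) : 0 < (-1 / τ).im := by
  have hτ₀ : τ ≠ 0 := fun h => by simp [h] at hτ
  rw [neg_div, one_div, neg_im, inv_im, neg_div, neg_neg]
  exact div_pos hτ (normSq_pos.2 hτ₀)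

lemma jacobiTheta₂_char_neg_one_div {τ : ℂ} (hτ : τ ≠ 0) (v w : ℂ) :
    exp (Real.pi * I * (v ^ 2 * (-1 / τ) + 2 * v * w)) *
        jacobiTheta₂ (v * (-1 / τ) + w) (-1 / τ) =
      (-I * τ) ^ (1 / 2 : ℂ) * exp (2 * Real.pi * I * (v * w)) *
        (exp (Real.pi * I * (w ^ 2 * τ + 2 * w * -v)) * jacobiTheta₂ (w * τ + -v) τ) := by
  have hexp : exp (Real.pi * I * (v ^ 2 * (-1 / τ) + 2 * v * w)) =
      exp (2 * Real.pi * I * (v * w)) * exp (Real.pi * I * (w ^ 2 * τ + 2 * w * -v)) *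
        exp (-Real.pi * I * (w * τ + -v) ^ 2 / τ) := by
    rw [← exp_add, ← exp_add]
    congr 1
    field_simp
    ring
  have harg : (w * τ + -v) / τ = v * (-1 / τ) + w := by
    field_simp
    ring
  rw [jacobiTheta₂_functional_equation (w * τ + -v), harg, hexp]
  field_simp

lemma thetaChar_C_neg_one_div (a : ℂ) {τ : ℂ} (hτ : 0 < τ.im) (v w : Fin n → ℂ) :
    thetaChar (C a) (-1 / τ) v w = ((-I * τ) ^ (1 / 2 : ℂ)) ^ n *
      exp (2 * Real.pi * I * v ⬝ᵥ w) * thetaChar (C a) τ w (-v) := by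
  have hτ₀ : τ ≠ 0 := fun h => by simp [h] at hτ
  have hexp : exp (2 * Real.pi * I * v ⬝ᵥ w) = ∏ i, exp (2 * Real.pi * I * (v i * w i)) := by
    rw [dotProduct, Finset.mul_sum, exp_sum]
  simp only [thetaChar_C a (im_neg_one_div_pos hτ), thetaChar_C a hτ, Pi.neg_apply,
    jacobiTheta₂_char_neg_one_div hτ₀, hexp, Finset.prod_mul_distrib,
    Finset.prod_const, Finset.card_univ, Fintype.card_fin]
  ring

lemma thetaChar_X_mul_neg_one_div {q : MvPolynomial (Fin n) ℂ} {τ c : ℂ} (hτ : 0 < τ.im)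
    {v : Fin n → ℂ}
    (hq : ∀ w, thetaChar q (-1 / τ) v w =
      c * (exp (2 * Real.pi * I * v ⬝ᵥ w) * thetaChar q τ w (-v)))
    (i : Fin n) (w : Fin n → ℂ) :
    2 * Real.pi * I * thetaChar (X i * q) (-1 / τ) v w =
      c * (exp (2 * Real.pi * I * v ⬝ᵥ w) * (thetaChar (pderiv i q) τ w (-v) +
        2 * Real.pi * I * τ * thetaChar (X i * q) τ w (-v))) := by
  refine (hasDerivAt_thetaChar_right q (im_neg_one_div_pos hτ) v w i).unique ?_
  have hexp : HasDerivAt (fun t : ℂ => exp (2 * Real.pi * I * v ⬝ᵥ (w + t • Pi.single i 1)))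
      (exp (2 * Real.pi * I * v ⬝ᵥ w) * (2 * Real.pi * I * v i)) 0 := by
    simpa [dotProduct_add] using
      ((((hasDerivAt_id (0 : ℂ)).mul_const (v i)).const_add (v ⬝ᵥ w)).const_mul
        (2 * Real.pi * I)).cexp
  simp only [hq]
  refine ((hexp.fun_mul (hasDerivAt_thetaChar_left q hτ w (-v) i)).const_mul c).congr_deriv ?_
  simp only [zero_smul, add_zero, Pi.neg_apply]
  ring

/-- Euler's identity writes a harmonic `p` of degree `ν + 1` through its partial derivatives, to
which the induction hypothesis applies; the extra terms `∂ᵢ ∂ᵢ p` produced by differentiating the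
left characteristic add up to the Laplacian of `p`. -/
theorem thetaChar_neg_one_div {ν : ℕ} {p : MvPolynomial (Fin n) ℂ} (hhom : p.IsHomogeneous ν)
    (hharm : IsHarmonic p) {τ : ℂ} (hτ : 0 < τ.im) (v w : Fin n → ℂ) :
    thetaChar p (-1 / τ) v w = τ ^ ν * ((-I * τ) ^ (1 / 2 : ℂ)) ^ n *
      (exp (2 * Real.pi * I * v ⬝ᵥ w) * thetaChar p τ w (-v)) := by
  induction ν generalizing p w with
  | zero =>
    obtain ⟨a, rfl⟩ : ∃ a, p = C a :=
      ⟨_, totalDegree_eq_zero_iff_eq_C.1 ((totalDegree_zero_iff_isHomogeneous _).2 hhom)⟩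
    rw [pow_zero, one_mul, thetaChar_C_neg_one_div a hτ, mul_assoc]
  | succ ν ih =>
    have euler {σ : ℂ} (hσ : 0 < σ.im) (v w : Fin n → ℂ) :
        ∑ i, thetaChar (X i * pderiv i p) σ v w = ((ν + 1 : ℕ) : ℂ) * thetaChar p σ v w := by
      rw [← thetaChar_sum _ _ hσ, hhom.sum_X_mul_pderiv, thetaChar_nsmul]
    have hlaplacian : ∑ i, thetaChar (pderiv i (pderiv i p)) τ w (-v) = 0 := by
      rw [← thetaChar_sum _ _ hτ]
      exact (congrArg (thetaChar · τ w (-v)) hharm).trans (by simp [thetaChar, thetaCharTerm])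
    have hpderiv (i : Fin n) := thetaChar_X_mul_neg_one_div hτ
      (fun w => ih (hhom.pderiv (i := i)) (hharm.pderiv i) w) i w
    have hsum := Finset.sum_congr (rfl : Finset.univ = Finset.univ) fun i _ => hpderiv i
    simp only [← Finset.mul_sum, Finset.sum_add_distrib, euler hτ, euler (im_neg_one_div_pos hτ),
      hlaplacian] at hsum
    have hν : 2 * Real.pi * I * ((ν + 1 : ℕ) : ℂ) ≠ 0 :=
      mul_ne_zero two_pi_I_ne_zero (Nat.cast_ne_zero.2 ν.succ_ne_zero)
    refine mul_left_cancel₀ hν ?_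
    rw [pow_succ]
    linear_combination hsum

end Inversion

section Translation

open Complex MvPolynomial

variable {n : ℕ}

lemma thetaChar_add_one (q : MvPolynomial (Fin n) ℂ) (τ : ℂ) (v w : Fin n → ℂ) :
    thetaChar q (τ + 1) v w =
      exp (-Real.pi * I * ∑ i, (v i ^ 2 + v i)) * thetaChar q τ v (w + v + 1 / 2) := by
  have hterm (x : Fin n → ℤ) : thetaCharTerm q (τ + 1) v w x =
      exp (-Real.pi * I * ∑ i, (v i ^ 2 + v i)) * thetaCharTerm q τ v (w + v + 1 / 2) x := by
    choose m hm using fun i => Int.even_mul_pred_self (x i)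
    have hm' (i : Fin n) : (x i : ℂ) * (x i - 1) = m i + m i := by exact_mod_cast hm i
    rw [thetaCharTerm, thetaCharTerm, mul_left_comm, ← exp_add]
    refine congrArg _ (exp_eq_exp_iff_exists_int.2 ⟨∑ i, m i, ?_⟩)
    simp only [Int.cast_sum, Finset.mul_sum, Finset.sum_mul, ← Finset.sum_add_distrib,
      Pi.add_apply, Pi.div_apply, Pi.ofNat_apply]
    exact Finset.sum_congr rfl fun i _ => by linear_combination Real.pi * I * hm' i
  simp only [thetaChar, hterm, tsum_mul_left]

lemma thetaChar_zero_add_two (q : MvPolynomial (Fin n) ℂ) (τ : ℂ) (w : Fin n → ℂ) :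
    thetaChar q (τ + 2) 0 w = thetaChar q τ 0 w := by
  refine tsum_congr fun x => congrArg _ (exp_eq_exp_iff_exists_int.2 ⟨∑ i, x i ^ 2, ?_⟩)
  simp only [Int.cast_sum, Int.cast_pow, Finset.mul_sum, Finset.sum_mul,
    ← Finset.sum_add_distrib, Pi.zero_apply]
  exact Finset.sum_congr rfl fun i _ => by ring

end Translation

section Theta

open Complex MvPolynomial
open ModularGroup (T)

variable {n : ℕ}

lemma im_two_mul_pos (z : ℍ) : 0 < (2 * (z : ℂ)).im := by
  simp [z.im_pos]

lemma thetaTerm_eq_thetaCharTerm (p : MvPolynomial (Fin n) ℂ) (z : ℍ) :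
    thetaTerm p z = thetaCharTerm p (2 * z) 0 0 := by
  ext x
  simp only [thetaTerm, thetaCharTerm, e, Pi.zero_apply, add_zero, mul_zero, ← Finset.sum_mul]
  congr 2
  ring

lemma theta_eq_thetaChar (p : MvPolynomial (Fin n) ℂ) (z : ℍ) :
    theta p z = thetaChar p (2 * z) 0 0 := by
  rw [theta, thetaTerm_eq_thetaCharTerm, thetaChar]

lemma summable_thetaTerm (p : MvPolynomial (Fin n) ℂ) (z : ℍ) : Summable (thetaTerm p z) := by
  rw [thetaTerm_eq_thetaCharTerm]
  exact summable_thetaCharTerm p (im_two_mul_pos z) 0 0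

lemma mdifferentiable_theta (p : MvPolynomial (Fin n) ℂ) :
    MDifferentiable 𝓘(ℂ) 𝓘(ℂ) (theta p) := by
  rw [UpperHalfPlane.mdifferentiable_iff]
  refine DifferentiableOn.congr (f := fun z => thetaChar p (2 * z) 0 0) (fun z hz => ?_)
    fun z hz => ?_
  · exact ((differentiableAt_thetaChar p (im_two_mul_pos ⟨z, hz⟩) 0 0).comp z
      (differentiableAt_id.const_mul 2)).differentiableWithinAt
  · simp [theta_eq_thetaChar, UpperHalfPlane.ofComplex_apply_of_im_pos hz]

lemma theta_T_smul (p : MvPolynomial (Fin n) ℂ) (z : ℍ) : theta p (T • z) = theta p z := by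
  rw [theta_eq_thetaChar, theta_eq_thetaChar, coe_T_smul, mul_add, mul_one,
    thetaChar_zero_add_two]

lemma thetaChar_zero_div_two_mul_add_one {ν : ℕ} {p : MvPolynomial (Fin n) ℂ}
    (hhom : p.IsHomogeneous ν) (hharm : IsHarmonic p) {τ : ℂ} (hτ : 0 < τ.im) :
    thetaChar p (τ / (2 * τ + 1)) 0 0 =
      (2 * τ + 1) ^ ν * ((2 * τ + 1) ^ (1 / 2 : ℂ)) ^ n * thetaChar p τ 0 0 := by
  have hτ₀ : τ ≠ 0 := fun h => by simp [h] at hτ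
  have hu : 2 * τ + 1 ≠ 0 := fun h => by simpa [hτ.ne'] using congrArg im h
  obtain ⟨τ', hτ'⟩ : ∃ τ', τ' = τ / (2 * τ + 1) := ⟨_, rfl⟩
  have hτu : τ = (2 * τ + 1) * τ' := by rw [hτ', mul_div_cancel₀ _ hu]
  -- `τ'` is obtained from `τ` by an inversion, a translation by `-2` and another inversion.
  have hshift : -1 / τ' + 2 = -1 / τ := by
    rw [hτ']
    field_simp
    ring
  have him : 0 < τ'.im := by
    have hinv : τ' = -1 / (-1 / τ - 2) := by
      rw [← hshift, add_sub_cancel_right, neg_div, neg_div, one_div, one_div, inv_neg, neg_neg,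
        inv_inv]
    rw [hinv]
    exact im_neg_one_div_pos (by simpa using im_neg_one_div_pos hτ)
  have hτ'₀ : τ' ≠ 0 := fun h => by simp [h] at him
  have hroot : (-I * τ') ^ (1 / 2 : ℂ) ≠ 0 := by simp [cpow_eq_zero_iff, hτ'₀]
  have hsqrt : (-I * τ) ^ (1 / 2 : ℂ) = (2 * τ + 1) ^ (1 / 2 : ℂ) * (-I * τ') ^ (1 / 2 : ℂ) := by
    have hquot : 2 * τ + 1 = -I * τ / (-I * τ') := by
      rw [mul_div_mul_left _ _ (neg_ne_zero.2 I_ne_zero), eq_div_iff hτ'₀, ← hτu]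
    rw [hquot, div_cpow_of_re_pos (by simpa using hτ) (by simpa using him),
      div_mul_cancel₀ _ hroot]
  have hinversion {σ : ℂ} (hσ : 0 < σ.im) : thetaChar p (-1 / σ) 0 0 =
      σ ^ ν * ((-I * σ) ^ (1 / 2 : ℂ)) ^ n * thetaChar p σ 0 0 := by
    simpa using thetaChar_neg_one_div hhom hharm hσ 0 0
  have hfunc := hinversion him
  rw [← thetaChar_zero_add_two, hshift, hinversion hτ, hsqrt] at hfunc
  have hpow : τ ^ ν = (2 * τ + 1) ^ ν * τ' ^ ν := by rw [← mul_pow, ← hτu]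
  rw [← hτ']
  refine mul_left_cancel₀ (mul_ne_zero (pow_ne_zero ν hτ'₀) (pow_ne_zero n hroot))
    (hfunc.symm.trans ?_)
  rw [hpow]
  ring

lemma theta_lowerFour_smul {ν : ℕ} {p : MvPolynomial (Fin n) ℂ} (hhom : p.IsHomogeneous ν)
    (hharm : IsHarmonic p) (z : ℍ) :
    theta p (lowerFour • z) = ((4 * (z : ℂ) + 1) ^ (1 / 2 : ℂ)) ^ (2 * ν + n) * theta p z := by
  have hsq : ((4 * (z : ℂ) + 1) ^ (1 / 2 : ℂ)) ^ 2 = 4 * z + 1 := by simp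
  have hfour : 2 * (2 * (z : ℂ)) + 1 = 4 * z + 1 := by ring
  have htransform := thetaChar_zero_div_two_mul_add_one hhom hharm (im_two_mul_pos z)
  rw [hfour, mul_div_assoc, ← coe_lowerFour_smul, ← theta_eq_thetaChar,
    ← theta_eq_thetaChar] at htransform
  rw [htransform, pow_add, pow_mul, hsq]

end Theta

section Cusps

open Complex MvPolynomial Filter Topology
open UpperHalfPlane (denom atImInfty IsZeroAtImInfty)
open ModularGroup (S T)

variable {n : ℕ}

/-- The theta series with real characteristic `u = (v, w)`, as a function on the upper half plane.
Up to the automorphy factor and a phase, `SL(2, ℤ)` permutes these functions. -/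
noncomputable def thetaRealChar (q : MvPolynomial (Fin n) ℂ) (u : (Fin n → ℝ) × (Fin n → ℝ))
    (τ : ℍ) : ℂ :=
  thetaChar q τ (fun i => u.1 i) (fun i => u.2 i)

lemma norm_thetaRealChar_T_smul (q : MvPolynomial (Fin n) ℂ) (u : (Fin n → ℝ) × (Fin n → ℝ))
    (τ : ℍ) : ‖thetaRealChar q u (T • τ)‖ = ‖thetaRealChar q (u.1, u.2 + u.1 + 1 / 2) τ‖ := by
  have hphase : ‖exp (-Real.pi * I * ∑ i, ((u.1 i : ℂ) ^ 2 + u.1 i))‖ = 1 := by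
    have := norm_exp_ofReal_mul_I (-Real.pi * ∑ i, (u.1 i ^ 2 + u.1 i))
    push_cast at this
    rwa [mul_right_comm] at this
  have hchar : (fun i => (u.2 i : ℂ)) + (fun i => (u.1 i : ℂ)) + 1 / 2 =
      fun i => ((u.2 + u.1 + 1 / 2) i : ℂ) := by
    ext i
    simp
  rw [thetaRealChar, coe_T_smul, thetaChar_add_one, norm_mul, hphase, one_mul, hchar,
    thetaRealChar]

lemma norm_thetaRealChar_S_smul {ν : ℕ} {p : MvPolynomial (Fin n) ℂ} (hhom : p.IsHomogeneous ν)
    (hharm : IsHarmonic p) (u : (Fin n → ℝ) × (Fin n → ℝ)) (τ : ℍ) :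
    ‖thetaRealChar p u (S • τ)‖ =
      ‖denom S τ‖ ^ (ν + n / 2 : ℝ) * ‖thetaRealChar p (u.2, -u.1) τ‖ := by
  have hphase : ‖exp (2 * Real.pi * I * dotProduct (fun i => (u.1 i : ℂ)) fun i => u.2 i)‖ = 1 := by
    have := norm_exp_ofReal_mul_I (2 * Real.pi * dotProduct u.1 u.2)
    simp only [dotProduct] at this ⊢
    push_cast at this
    rwa [mul_right_comm] at this
  have hfactor : ‖(τ : ℂ) ^ ν * ((-I * τ) ^ (1 / 2 : ℂ)) ^ n‖ = ‖denom S τ‖ ^ (ν + n / 2 : ℝ) := by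
    have hhalf : (1 / 2 : ℂ) = ((1 / 2 : ℝ) : ℂ) := by norm_num
    rw [ModularGroup.denom_S, norm_mul, norm_pow, norm_pow, hhalf, norm_cpow_real, norm_mul,
      norm_neg, norm_I, one_mul, ← Real.rpow_mul_natCast (norm_nonneg _), one_div_mul_eq_div,
      Real.rpow_add (norm_pos_iff.2 τ.ne_zero), Real.rpow_natCast]
  have hchar : -(fun i => (u.1 i : ℂ)) = fun i => ((-u.1) i : ℂ) := by
    ext i
    simp
  rw [thetaRealChar, coe_S_smul, thetaChar_neg_one_div hhom hharm τ.im_pos, norm_mul, hfactor,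
    norm_mul, hphase, one_mul, hchar, thetaRealChar]

lemma exists_perm_norm_thetaRealChar_smul {ν : ℕ} {p : MvPolynomial (Fin n) ℂ}
    (hhom : p.IsHomogeneous ν) (hharm : IsHarmonic p) (g : SL(2, ℤ)) :
    ∃ σ : Equiv.Perm ((Fin n → ℝ) × (Fin n → ℝ)), ∀ u τ, ‖thetaRealChar p u (g • τ)‖ =
      ‖denom g τ‖ ^ (ν + n / 2 : ℝ) * ‖thetaRealChar p (σ u) τ‖ := by
  have hg : g ∈ Subgroup.closure {S, T} := by simp [SpecialLinearGroup.SL2Z_generators]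
  induction hg using Subgroup.closure_induction with
  | mem g hg =>
    rcases hg with rfl | rfl
    · exact ⟨⟨fun u => (u.2, -u.1), fun u => (-u.2, u.1), fun u => by simp, fun u => by simp⟩,
        norm_thetaRealChar_S_smul hhom hharm⟩
    · refine ⟨⟨fun u => (u.1, u.2 + u.1 + 1 / 2), fun u => (u.1, u.2 - 1 / 2 - u.1),
        fun u => by simp, fun u => by simp⟩, fun u τ => ?_⟩
      rw [norm_thetaRealChar_T_smul, denom_T]
      simp
  | one => exact ⟨1, fun u τ => by simp⟩
  | mul g h _ _ ihg ihh =>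
    obtain ⟨σ, hσ⟩ := ihg
    obtain ⟨ρ, hρ⟩ := ihh
    refine ⟨ρ * σ, fun u τ => ?_⟩
    rw [mul_smul, hσ, hρ, denom_mul, norm_mul, Real.mul_rpow (norm_nonneg _) (norm_nonneg _)]
    simp only [Equiv.Perm.mul_apply]
    ring
  | inv g _ ih =>
    obtain ⟨σ, hσ⟩ := ih
    refine ⟨σ.symm, fun u τ => ?_⟩
    have hdenom : ‖denom (g⁻¹ : SL(2, ℤ)) τ‖ * ‖denom g (g⁻¹ • τ : ℍ)‖ = 1 := by
      rw [← norm_mul, mul_comm, ← denom_mul, mul_inv_cancel]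
      simp
    have hτ := hσ (σ.symm u) (g⁻¹ • τ)
    rw [smul_inv_smul, σ.apply_symm_apply] at hτ
    rw [hτ, ← mul_assoc, ← Real.mul_rpow (norm_nonneg _) (norm_nonneg _), hdenom,
      Real.one_rpow, one_mul]

lemma norm_thetaCharTerm_ofReal (q : MvPolynomial (Fin n) ℂ) (τ : ℂ) (v w : Fin n → ℝ)
    (x : Fin n → ℤ) :
    ‖thetaCharTerm q τ (fun i => v i) (fun i => w i) x‖ =
      ‖eval (fun i => (x i + v i : ℂ)) q‖ *
        Real.exp (-(Real.pi * (∑ i, (x i + v i) ^ 2) * τ.im)) := by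
  have hsplit : Real.pi * I * ∑ i, ((x i + v i : ℂ) ^ 2 * τ + 2 * (x i + v i) * w i) =
      ((Real.pi * ∑ i, (x i + v i) ^ 2 : ℝ) : ℂ) * (I * τ) +
        ((Real.pi * ∑ i, 2 * (x i + v i) * w i : ℝ) : ℂ) * I := by
    rw [Finset.sum_add_distrib, ← Finset.sum_mul]
    push_cast
    ring
  rw [thetaCharTerm, norm_mul, norm_exp, hsplit, add_re, re_ofReal_mul, re_ofReal_mul, I_mul_re,
    I_re, mul_zero, add_zero, mul_neg]

lemma isZeroAtImInfty_thetaRealChar {q : MvPolynomial (Fin n) ℂ} (hq : eval 0 q = 0)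
    (u : (Fin n → ℝ) × (Fin n → ℝ)) : IsZeroAtImInfty (thetaRealChar q u) := by
  have hbound : Summable fun x => ‖thetaCharTerm q I (fun i => u.1 i) (fun i => u.2 i) x‖ :=
    (summable_thetaCharTerm q (by simp) _ _).norm
  have him : Tendsto UpperHalfPlane.im atImInfty atTop := tendsto_comap
  suffices h : Tendsto (thetaRealChar q u) atImInfty (𝓝 (∑' _ : Fin n → ℤ, 0)) by
    rwa [tsum_zero] at h
  refine tendsto_tsum_of_dominated_convergence hbound (fun x => ?_) ?_
  · rw [tendsto_zero_iff_norm_tendsto_zero]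
    simp only [norm_thetaCharTerm_ofReal]
    by_cases hx : ∀ i, (x i : ℝ) + u.1 i = 0
    · have hx' : (fun i => (x i + u.1 i : ℂ)) = 0 := funext fun i => by
        rw [Pi.zero_apply]
        exact_mod_cast hx i
      rw [hx', hq]
      simp
    · push Not at hx
      obtain ⟨i, hi⟩ := hx
      have hpos : 0 < ∑ i, (x i + u.1 i) ^ 2 :=
        Finset.sum_pos' (fun i _ => sq_nonneg _) ⟨i, Finset.mem_univ i, by positivity⟩
      rw [← mul_zero ‖eval (fun i => (x i + u.1 i : ℂ)) q‖]
      exact (Real.tendsto_exp_neg_atTop_nhds_zero.comp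
        (him.const_mul_atTop (mul_pos Real.pi_pos hpos))).const_mul _
  · filter_upwards [him.eventually_ge_atTop 1] with τ hτ x
    simp only [norm_thetaCharTerm_ofReal, UpperHalfPlane.coe_im, I_im]
    gcongr

lemma det_eq_one (g : SL(2, ℤ)) : g 0 0 * g 1 1 - g 0 1 * g 1 0 = 1 := by
  rw [← Matrix.det_fin_two, g.det_coe]

lemma coe_smul_eq_div_denom (g : SL(2, ℤ)) (z : ℍ) :
    ((g • z : ℍ) : ℂ) = (g 0 0 * z + g 0 1) / denom g z := by
  simp [UpperHalfPlane.specialLinearGroup_apply, ModularGroup.denom_apply]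

lemma exists_two_mul_smul_of_even {g : SL(2, ℤ)} {c : ℤ} (hc : g 1 0 = 2 * c) :
    ∃ g' : SL(2, ℤ), ∀ z w : ℍ, (w : ℂ) = 2 * z →
      2 * ((g • z : ℍ) : ℂ) = (g' • w : ℍ) ∧ denom g' w = denom g z := by
  obtain ⟨g', hg'⟩ : ∃ g' : SL(2, ℤ), g'.1 = !![g 0 0, 2 * g 0 1; c, g 1 1] := by
    refine ⟨⟨_, ?_⟩, rfl⟩
    rw [Matrix.det_fin_two_of]
    linear_combination det_eq_one g + g 0 1 * hc
  refine ⟨g', fun z w hw => ?_⟩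
  have hdenom : denom g' w = denom g z := by
    rw [ModularGroup.denom_apply, ModularGroup.denom_apply, hg', hc, hw]
    simp
    ring
  refine ⟨?_, hdenom⟩
  rw [coe_smul_eq_div_denom, coe_smul_eq_div_denom, hdenom, hg', hw]
  simp
  ring

lemma exists_two_mul_smul_of_odd {g : SL(2, ℤ)} {c : ℤ} (hc : g 1 0 = 2 * c + 1) :
    ∃ g' : SL(2, ℤ), ∀ z w : ℍ, (w : ℂ) = (z + g 1 1) / 2 →
      2 * ((g • z : ℍ) : ℂ) = (g' • w : ℍ) ∧ denom g' w = denom g z / 2 := by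
  obtain ⟨g', hg'⟩ : ∃ g' : SL(2, ℤ),
      g'.1 = !![2 * g 0 0, g 0 1 - g 0 0 * g 1 1; g 1 0, -c * g 1 1] := by
    refine ⟨⟨_, ?_⟩, rfl⟩
    rw [Matrix.det_fin_two_of]
    linear_combination det_eq_one g + g 0 0 * g 1 1 * hc
  refine ⟨g', fun z w hw => ?_⟩
  have hdenom : denom g' w = denom g z / 2 := by
    rw [ModularGroup.denom_apply, ModularGroup.denom_apply, hg', hw]
    simp [hc]
    ring
  refine ⟨?_, hdenom⟩
  rw [coe_smul_eq_div_denom, coe_smul_eq_div_denom, hdenom, hg', hw]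
  simp
  ring

lemma exists_two_mul_smul (g : SL(2, ℤ)) :
    ∃ (g' : SL(2, ℤ)) (φ : ℍ → ℍ) (K : ℝ), 0 ≤ K ∧ Tendsto φ atImInfty atImInfty ∧
      ∀ z : ℍ, 2 * ((g • z : ℍ) : ℂ) = (g' • φ z : ℍ) ∧
        ‖denom g' (φ z)‖ = K * ‖denom g z‖ := by
  have him : Tendsto UpperHalfPlane.im atImInfty atTop := tendsto_comap
  rcases Int.even_or_odd' (g 1 0) with ⟨c, hc | hc⟩
  · obtain ⟨g', hg'⟩ := exists_two_mul_smul_of_even hc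
    refine ⟨g', fun z => ⟨2 * z, im_two_mul_pos z⟩, 1, zero_le_one,
      tendsto_comap_iff.2 ?_, fun z => ?_⟩
    · exact (him.const_mul_atTop zero_lt_two).congr fun z => by
        simp [← UpperHalfPlane.coe_im]
    · obtain ⟨hsmul, hdenom⟩ := hg' z ⟨_, _⟩ rfl
      exact ⟨hsmul, by rw [hdenom, one_mul]⟩
  · obtain ⟨g', hg'⟩ := exists_two_mul_smul_of_odd hc
    refine ⟨g', fun z => ⟨(z + g 1 1) / 2, by simp [z.im_pos]⟩, 1 / 2, by norm_num,
      tendsto_comap_iff.2 ?_, fun z => ?_⟩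
    · exact (him.atTop_div_const zero_lt_two).congr fun z => by
        simp [← UpperHalfPlane.coe_im]
    · obtain ⟨hsmul, hdenom⟩ := hg' z ⟨_, _⟩ rfl
      refine ⟨hsmul, ?_⟩
      rw [hdenom, norm_div, norm_ofNat, one_div_mul_eq_div]

lemma eval_zero_of_isHomogeneous {R : Type*} [CommSemiring R] {s : Type*} {ν : ℕ} (hν : ν ≠ 0)
    {p : MvPolynomial s R} (hhom : p.IsHomogeneous ν) : eval 0 p = 0 := by
  rw [eval_zero, constantCoeff_eq]
  exact hhom.coeff_eq_zero (by simpa using hν.symm)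

lemma isZeroAtImInfty_theta {ν : ℕ} (hν : ν ≠ 0) {p : MvPolynomial (Fin n) ℂ}
    (hhom : p.IsHomogeneous ν) (hharm : IsHarmonic p) (g : SL(2, ℤ)) :
    IsZeroAtImInfty fun z : ℍ =>
      denom g z ^ (-((2 * ν + n : ℕ) : ℂ) / 2) * theta p (g • z) := by
  obtain ⟨g', φ, K, hK, hφ, hg'⟩ := exists_two_mul_smul g
  obtain ⟨σ, hσ⟩ := exists_perm_norm_thetaRealChar_smul hhom hharm g'
  have hweight : -((2 * ν + n : ℕ) : ℂ) / 2 = ((-(ν + n / 2) : ℝ) : ℂ) := by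
    push_cast
    ring
  have htheta (z : ℍ) : theta p (g • z) = thetaRealChar p 0 (g' • φ z) := by
    rw [theta_eq_thetaChar, (hg' z).1, thetaRealChar]
    simp [Pi.zero_def]
  have hnorm (z : ℍ) : ‖denom g z ^ (-((2 * ν + n : ℕ) : ℂ) / 2) * theta p (g • z)‖ =
      K ^ (ν + n / 2 : ℝ) * ‖thetaRealChar p (σ 0) (φ z)‖ := by
    have hdenom : ‖denom g z‖ ^ (ν + n / 2 : ℝ) ≠ 0 :=
      (Real.rpow_pos_of_pos (norm_pos_iff.2 (UpperHalfPlane.denom_ne_zero g z)) _).ne'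
    rw [norm_mul, hweight, norm_cpow_real, Real.rpow_neg (norm_nonneg _), htheta, hσ, (hg' z).2,
      Real.mul_rpow hK (norm_nonneg _), mul_comm (K ^ _), mul_assoc, inv_mul_cancel_left₀ hdenom]
  have hlim := (isZeroAtImInfty_thetaRealChar
    (eval_zero_of_isHomogeneous hν hhom) (σ 0)).norm.comp hφ
  rw [IsZeroAtImInfty, ZeroAtFilter, tendsto_zero_iff_norm_tendsto_zero]
  simp only [hnorm]
  simpa [Function.comp_def] using hlim.const_mul (K ^ (ν + n / 2 : ℝ))

end Cusps

end ThetaHarmonic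

open ThetaHarmonic in
theorem mainTheorem5_general (n ν : ℕ) (p : MvPolynomial (Fin n) ℂ)
    (hhom : p.IsHomogeneous ν) (hharm : IsHarmonic p) :
    (∀ z : ℍ, Summable (thetaTerm p z)) ∧
    MDifferentiable 𝓘(ℂ) 𝓘(ℂ) (theta p) ∧
    (∀ γ ∈ CongruenceSubgroup.Gamma0 4, ∀ z : ℍ,
      theta p (γ • z) = thetaMultiplier γ z ^ (2 * ν + n) * theta p z) ∧
    (0 < ν → IsCuspFormGamma0Four (2 * ν + n) (theta p)) := by
  have htransform :=
    transform_of_generators (theta_T_smul p) (theta_lowerFour_smul hhom hharm)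
  exact ⟨summable_thetaTerm p, mdifferentiable_theta p, htransform, fun hν =>
    ⟨mdifferentiable_theta p, htransform, isZeroAtImInfty_theta hν.ne' hhom hharm⟩⟩

theorem mainTheorem5 (n : ℕ) (hn : 2 ≤ n) (ν : ℕ) (p : MvPolynomial (Fin n) ℂ)
    (hhom : p.IsHomogeneous ν) (hharm : ThetaHarmonic.IsHarmonic p) :
    (∀ z : ℍ, Summable (ThetaHarmonic.thetaTerm p z)) ∧
    MDifferentiable 𝓘(ℂ) 𝓘(ℂ) (ThetaHarmonic.theta p) ∧
    (∀ γ ∈ CongruenceSubgroup.Gamma0 4, ∀ z : ℍ,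
      ThetaHarmonic.theta p (γ • z) =
        ThetaHarmonic.thetaMultiplier γ z ^ (2 * ν + n) * ThetaHarmonic.theta p z) ∧
    (0 < ν → ThetaHarmonic.IsCuspFormGamma0Four (2 * ν + n) (ThetaHarmonic.theta p)) :=
  mainTheorem5_general n ν p hhom hharm
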